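/- Let $I\subseteq\mathbb{R}$ be a nondegenerate interval (open, closed or half-open, bounded or unbounded). A sequence $(f_n\colon I\to\mathbb{R})_{n=1}^\infty$ of continuous functions with $f_1\le f_2\le\cdots$ pointwise on $I$ is called a max-family if $$\lim_{n\to\infty}\int_x^y f_n(t)\,dt=+\infty\qquad\text{for all }x,y\in I\text{ with }x<y,$$ and one puts $I_f:=\{x\in I:\lim_{n\to\infty}f_n(x)=+\infty\}$. Theorem. For every nondegenerate interval $I\subseteq\mathbb{R}$ and every $\theta\in[0,1]$ there exists a max-family $(f_n\colon I\to\mathbb{R})_{n=1}^\infty$ such that $$\dim_H(I_f\cap U)=\theta$$ for every nonempty subinterval $U$ of $I$ that is open in $I$ (in particular for every nonempty open interval $U\subseteq I$), where $\dim_H$ denotes the Hausdorff dimension. -/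

import Mathlib

open Set Filter MeasureTheory

namespace MaxFamily

/-- The set `I_f` of all points of `I` at which `f n` tends to `+∞`. -/
def infinitySet (I : Set ℝ) (f : ℕ → ℝ → ℝ) : Set ℝ :=
  {x | x ∈ I ∧ Tendsto (fun n => f n x) atTop atTop}

/-- `f` is a max-family on the interval `I`: a pointwise nondecreasing sequence of continuous
functions on `I` whose integrals over every nondegenerate `[x, y] ⊆ I` tend to `+∞`.
Only the values of `f n` on `I` matter. -/
structure IsMaxFamily (I : Set ℝ) (f : ℕ → ℝ → ℝ) : Prop where
  continuousOn : ∀ n, ContinuousOn (f n) I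
  le_succ : ∀ n, ∀ x ∈ I, f n x ≤ f (n + 1) x
  tendsto_integral : ∀ x ∈ I, ∀ y ∈ I, x < y →
    Tendsto (fun n => ∫ t in x..y, f n t) atTop atTop

/-- `U` is a nonempty subinterval of `I` that is open in the subspace topology of `I`. This covers
every nonempty open interval of `ℝ` contained in `I`, and also e.g. `[0, 1/2)` in `I = [0, 1]`. -/
structure IsOpenSubinterval (I U : Set ℝ) : Prop where
  nonempty : U.Nonempty
  ordConnected : U.OrdConnected
  relOpen : ∃ O : Set ℝ, IsOpen O ∧ U = I ∩ O

end MaxFamily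

/-! For a dense Gδ set `G = ⋂ k, O k`, with `O k` open and decreasing, put `g = ∑ k, w k • 1_{O k}`
with weights `w k ≥ 1`. Then `g = ∞` exactly on `G`, and since each `O k` is dense, weights growing
fast enough make `g` nonintegrable on every interval. As `g` is an increasing limit of continuous
functions, `G` is the infinity set of a max-family.

It remains to find a dense Gδ set of local dimension `θ` everywhere. Start from a bounded set of
dimension `θ` (a self-similar Cantor set if `0 < θ < 1`), place countably many small copies of it
in every open set, and enclose their union in a Gδ set of the same dimension.
-/

namespace MaxFamily

open Metric
open scoped ENNReal NNReal Pointwise Topology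

section GδHull

variable {X : Type*}

theorem exists_isOpen_superset_ediam_rpow_le [PseudoEMetricSpace X] {d : ℝ} (hd : 0 ≤ d)
    (t : Set X) {ε : ℝ≥0∞} (hε : ε ≠ 0) :
    ∃ U, IsOpen U ∧ t ⊆ U ∧ ediam U ^ d ≤ ediam t ^ d + ε := by
  rcases eq_or_ne (ediam t) ∞ with htop | hfin
  · refine ⟨univ, isOpen_univ, subset_univ t, le_add_right ?_⟩
    exact ENNReal.rpow_le_rpow (htop ▸ le_top) hd
  have hcont : Continuous fun δ : ℝ≥0 => (ediam t + 2 * (δ : ℝ≥0∞)) ^ d :=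
    ENNReal.continuous_rpow_const.comp <| continuous_const.add <|
      (ENNReal.continuous_const_mul ENNReal.ofNat_ne_top).comp ENNReal.continuous_coe
  have hlt : (ediam t + 2 * ((0 : ℝ≥0) : ℝ≥0∞)) ^ d < ediam t ^ d + ε := by
    simpa using ENNReal.lt_add_right (ENNReal.rpow_ne_top_of_nonneg hd hfin) hε
  have hsmall : ∀ᶠ δ : ℝ≥0 in 𝓝[>] 0, (ediam t + 2 * (δ : ℝ≥0∞)) ^ d < ediam t ^ d + ε :=
    nhdsWithin_le_nhds (hcont.continuousAt.eventually_lt_const hlt)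
  obtain ⟨δ, hδ, hδ0⟩ := (hsmall.and self_mem_nhdsWithin).exists
  exact ⟨thickening δ t, isOpen_thickening, self_subset_thickening (NNReal.coe_pos.2 hδ0) t,
    (ENNReal.rpow_le_rpow (ediam_thickening_le δ) hd).trans hδ.le⟩

variable [EMetricSpace X]

section HausdorffMeasure

variable [MeasurableSpace X] [BorelSpace X] {d : ℝ} (hd : 0 < d) {s : Set X}
include hd

theorem exists_isOpen_cover_tsum_ediam_rpow_le (hs : Measure.hausdorffMeasure d s = 0)
    {ε : ℝ≥0∞} (hε : ε ≠ 0) :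
    ∃ U : ℕ → Set X, (∀ i, IsOpen (U i)) ∧ s ⊆ ⋃ i, U i ∧ ∑' i, ediam (U i) ^ d ≤ ε := by
  have hε2 : ε / 2 ≠ 0 := (ENNReal.half_pos hε).ne'
  obtain ⟨t, hst, hsum⟩ : ∃ t : ℕ → Set X, s ⊆ ⋃ i, t i ∧ ∑' i, ediam (t i) ^ d < ε / 2 := by
    rw [Measure.hausdorffMeasure_apply] at hs
    have hcover := (ENNReal.iSup_eq_zero.1 ((ENNReal.iSup_eq_zero.1 hs) ∞) ENNReal.zero_lt_top
      ).trans_lt (ENNReal.half_pos hε)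
    simp only [iInf_lt_iff] at hcover
    obtain ⟨t, hst, -, hsum⟩ := hcover
    refine ⟨t, hst, (ENNReal.tsum_le_tsum fun i => ?_).trans_lt hsum⟩
    rcases (t i).eq_empty_or_nonempty with hempty | hne
    · simp [hempty, hd]
    · simp [hne]
  obtain ⟨e, he, hesum⟩ := ENNReal.exists_pos_sum_of_countable' hε2 ℕ
  choose U hUo htU hU using fun i =>
    exists_isOpen_superset_ediam_rpow_le hd.le (t i) (he i).ne'
  refine ⟨U, hUo, hst.trans (iUnion_mono htU), ?_⟩
  calc ∑' i, ediam (U i) ^ d ≤ ∑' i, (ediam (t i) ^ d + e i) := ENNReal.tsum_le_tsum hU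
    _ = ∑' i, ediam (t i) ^ d + ∑' i, e i := ENNReal.tsum_add
    _ ≤ ε / 2 + ε / 2 := add_le_add hsum.le hesum.le
    _ = ε := ENNReal.add_halves ε

theorem hausdorffMeasure_eq_zero_of_forall_exists_cover
    (h : ∀ ε : ℝ≥0∞, ε ≠ 0 → ∃ t : ℕ → Set X, s ⊆ ⋃ i, t i ∧ ∑' i, ediam (t i) ^ d ≤ ε) :
    Measure.hausdorffMeasure d s = 0 := by
  choose t hst hsum using fun n : ℕ => h (n : ℝ≥0∞)⁻¹ (ENNReal.inv_ne_zero.2 (by simp))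
  -- No condition on the mesh is needed: a single term of the sum already bounds the diameters.
  have hdiam (n i : ℕ) : ediam (t n i) ≤ (n : ℝ≥0∞)⁻¹ ^ d⁻¹ :=
    (ENNReal.le_rpow_inv_iff hd).2 ((ENNReal.le_tsum i).trans (hsum n))
  have hmesh : Tendsto (fun n : ℕ => (n : ℝ≥0∞)⁻¹ ^ d⁻¹) atTop (𝓝 0) := by
    simpa [hd] using ENNReal.tendsto_inv_nat_nhds_zero.ennrpow_const d⁻¹
  refine le_antisymm ?_ zero_le
  calc Measure.hausdorffMeasure d s ≤ liminf (fun n => ∑' i, ediam (t n i) ^ d) atTop :=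
        Measure.hausdorffMeasure_le_liminf_tsum d s _ hmesh t (.of_forall hdiam) (.of_forall hst)
    _ ≤ liminf (fun n : ℕ => (n : ℝ≥0∞)⁻¹) atTop := liminf_le_liminf (.of_forall hsum)
    _ = 0 := ENNReal.tendsto_inv_nat_nhds_zero.liminf_eq

theorem exists_isGδ_superset_hausdorffMeasure_eq_zero (hs : Measure.hausdorffMeasure d s = 0) :
    ∃ G, s ⊆ G ∧ IsGδ G ∧ Measure.hausdorffMeasure d G = 0 := by
  choose U hUo hsU hU using fun n : ℕ =>
    exists_isOpen_cover_tsum_ediam_rpow_le hd hs (ENNReal.inv_ne_zero.2 (ENNReal.natCast_ne_top n))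
  refine ⟨⋂ n, ⋃ i, U n i, subset_iInter hsU,
    .iInter_of_isOpen fun n => isOpen_iUnion (hUo n), ?_⟩
  refine hausdorffMeasure_eq_zero_of_forall_exists_cover hd fun ε hε => ?_
  obtain ⟨n, hn⟩ := ENNReal.exists_inv_nat_lt hε
  exact ⟨U n, iInter_subset _ n, (hU n).trans hn.le⟩

end HausdorffMeasure

theorem exists_isGδ_superset_dimH_eq (s : Set X) : ∃ G, s ⊆ G ∧ IsGδ G ∧ dimH G = dimH s := by
  borelize X
  rcases eq_or_ne (dimH s) ∞ with htop | hfin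
  · exact ⟨univ, subset_univ s, .univ,
      le_antisymm (htop ▸ le_top) (dimH_mono (subset_univ s))⟩
  obtain ⟨θ, hθ⟩ : ∃ θ : ℝ≥0, (θ : ℝ≥0∞) = dimH s := ⟨_, ENNReal.coe_toNNReal hfin⟩
  obtain ⟨u, -, hθu, hu⟩ := exists_seq_strictAnti_tendsto θ
  choose G hsG hG hG0 using fun n => exists_isGδ_superset_hausdorffMeasure_eq_zero
    (NNReal.coe_pos.2 (pos_of_gt (hθu n)))
    (hausdorffMeasure_of_dimH_lt (hθ ▸ ENNReal.coe_lt_coe.2 (hθu n)))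
  have hle (n : ℕ) : dimH (⋂ n, G n) ≤ u n :=
    (dimH_mono (iInter_subset G n)).trans
      (dimH_le_of_hausdorffMeasure_ne_top (by simp [hG0 n]))
  exact ⟨⋂ n, G n, subset_iInter hsG, .iInter hG, le_antisymm
    (hθ ▸ ge_of_tendsto' (ENNReal.tendsto_coe.2 hu) hle) (dimH_mono (subset_iInter hsG))⟩

end GδHull

section SmallCopies

theorem dimH_singleton_add_smul {𝕜 E : Type*} [NontriviallyNormedField 𝕜]
    [NormedAddCommGroup E] [NormedSpace 𝕜 E] (x : E) {c : 𝕜} (hc : c ≠ 0) (s : Set E) :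
    dimH ({x} + c • s) = dimH s := by
  rw [singleton_add, (isometry_add_left x).dimH_image]
  exact (ContinuousLinearEquiv.smulLeft (R₁ := 𝕜) (M₁ := E) (Units.mk0 c hc)).dimH_image s

theorem exists_isGδ_dense_forall_dimH_inter_eq (𝕜 : Type*) [NontriviallyNormedField 𝕜]
    {E : Type*} [NormedAddCommGroup E] [NormedSpace 𝕜 E] [TopologicalSpace.SeparableSpace E]
    {C : Set E} (hne : C.Nonempty) (hbdd : Bornology.IsBounded C) :
    ∃ G : Set E, IsGδ G ∧ Dense G ∧ ∀ U, IsOpen U → U.Nonempty → dimH (G ∩ U) = dimH C := by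
  obtain ⟨c, hc0, hc1⟩ := NormedField.exists_norm_lt_one 𝕜
  let copy (p : ℕ × ℕ) : Set E := {TopologicalSpace.denseSeq E p.1} + c ^ p.2 • C
  have hcopy (p : ℕ × ℕ) : dimH (copy p) = dimH C :=
    dimH_singleton_add_smul _ (pow_ne_zero _ (norm_pos_iff.1 hc0)) C
  obtain ⟨G, hFG, hG, hdimG⟩ := exists_isGδ_superset_dimH_eq (⋃ p, copy p)
  have hcopyU {U : Set E} (hU : IsOpen U) (hUne : U.Nonempty) : ∃ p, copy p ⊆ G ∩ U := by
    obtain ⟨k, hk⟩ := (TopologicalSpace.denseRange_denseSeq E).exists_mem_open hU hUne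
    obtain ⟨n, hn⟩ := ((tendsto_pow_atTop_nhds_zero_of_norm_lt_one hc1).eventually
      (eventually_singleton_add_smul_subset hbdd (hU.mem_nhds hk))).exists
    exact ⟨(k, n), subset_inter ((subset_iUnion copy _).trans hFG) hn⟩
  refine ⟨G, hG, dense_iff_inter_open.2 fun U hU hUne => ?_, fun U hU hUne => le_antisymm ?_ ?_⟩
  · obtain ⟨p, hp⟩ := hcopyU hU hUne
    rw [inter_comm]
    exact ((singleton_nonempty _).add hne.smul_set).mono hp
  · refine (dimH_mono inter_subset_left).trans ?_
    rw [hdimG, dimH_iUnion]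
    exact iSup_le fun p => (hcopy p).le
  · obtain ⟨p, hp⟩ := hcopyU hU hUne
    exact (hcopy p).symm.trans_le (dimH_mono hp)

end SmallCopies

section SymbolicCoding

theorem dimH_range_le_div_of_edist_le {α X Y : Type*} [EMetricSpace X] [EMetricSpace Y]
    {f : α → X} {g : α → Y} {C r : ℝ≥0} (hr : 0 < r)
    (h : ∀ a b, edist (g a) (g b) ≤ C * edist (f a) (f b) ^ (r : ℝ)) :
    dimH (range g) ≤ dimH (range f) / r := by
  let φ : range f → Y := g ∘ rangeSplitting f
  have hφ : HolderWith C r φ := fun x y => by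
    simpa [φ, apply_rangeSplitting, Subtype.edist_eq] using
      h (rangeSplitting f x) (rangeSplitting f y)
  have hrange : range g ⊆ range φ := by
    rintro _ ⟨a, rfl⟩
    refine ⟨⟨f a, a, rfl⟩, edist_le_zero.1 ?_⟩
    simpa [φ, apply_rangeSplitting, hr] using h (rangeSplitting f ⟨f a, a, rfl⟩) a
  have huniv : dimH (univ : Set (range f)) = dimH (range f) := by
    rw [← isometry_subtype_coe.dimH_image, image_univ, Subtype.range_coe]
  exact (dimH_mono hrange).trans ((hφ.dimH_range_le hr).trans_eq (by rw [huniv]))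

variable {X : Type*} [EMetricSpace X] {b : ℕ} {f : (ℕ → Fin b) → X} {C r d : ℝ≥0}

theorem dimH_range_le_of_edist_le_pow
    (hf : ∀ n a a', (∀ i < n, a i = a' i) → edist (f a) (f a') ≤ C * r ^ n)
    (hr : r < 1) (hd : b * r ^ (d : ℝ) ≤ 1) : dimH (range f) ≤ d := by
  borelize X
  let cyl (n : ℕ) (w : Fin n → Fin b) : Set X := f '' {a | ∀ i : Fin n, a i = w i}
  have hdiam (n : ℕ) (w : Fin n → Fin b) : ediam (cyl n w) ≤ C * r ^ n := by
    refine ediam_le ?_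
    rintro _ ⟨a, ha, rfl⟩ _ ⟨a', ha', rfl⟩
    exact hf n a a' fun i hi => (ha ⟨i, hi⟩).trans (ha' ⟨i, hi⟩).symm
  have hmesh : Tendsto (fun n => (C * r ^ n : ℝ≥0∞)) atTop (𝓝 0) := by
    simpa using ENNReal.Tendsto.const_mul (a := (C : ℝ≥0∞))
      (ENNReal.tendsto_pow_atTop_nhds_zero_of_lt_one (ENNReal.coe_lt_one_iff.2 hr))
      (.inr ENNReal.coe_ne_top)
  have hsum (n : ℕ) : ∑ w, ediam (cyl n w) ^ (d : ℝ) ≤ (C : ℝ≥0∞) ^ (d : ℝ) := by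
    calc ∑ w, ediam (cyl n w) ^ (d : ℝ)
        ≤ ∑ _w : Fin n → Fin b, (C * r ^ n : ℝ≥0∞) ^ (d : ℝ) :=
          Finset.sum_le_sum fun w _ => ENNReal.rpow_le_rpow (hdiam n w) d.coe_nonneg
      _ = (C : ℝ≥0∞) ^ (d : ℝ) * (b * (r : ℝ≥0∞) ^ (d : ℝ)) ^ n := by
          simp only [Finset.sum_const, Finset.card_univ, Fintype.card_fun, Fintype.card_fin,
            nsmul_eq_mul, Nat.cast_pow, ENNReal.mul_rpow_of_nonneg _ _ d.coe_nonneg, mul_pow,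
            ← ENNReal.rpow_natCast_mul, ← ENNReal.rpow_mul_natCast]
          ring_nf
      _ ≤ (C : ℝ≥0∞) ^ (d : ℝ) := by
          refine mul_le_of_le_one_right' (pow_le_one' ?_ n)
          rw [← ENNReal.coe_rpow_of_nonneg _ d.coe_nonneg]
          exact_mod_cast hd
  have hcover (n : ℕ) : range f ⊆ ⋃ w, cyl n w := by
    rintro _ ⟨a, rfl⟩
    exact mem_iUnion.2 ⟨fun i => a i, a, fun i => rfl, rfl⟩
  have hmeasure : Measure.hausdorffMeasure d (range f) ≤ (C : ℝ≥0∞) ^ (d : ℝ) :=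
    (Measure.hausdorffMeasure_le_liminf_sum d _ _ hmesh cyl
      (.of_forall hdiam) (.of_forall hcover)).trans
      ((liminf_le_liminf (.of_forall hsum)).trans_eq (liminf_const _))
  exact dimH_le_of_hausdorffMeasure_ne_top (ne_top_of_le_ne_top
    (ENNReal.rpow_ne_top_of_nonneg d.coe_nonneg ENNReal.coe_ne_top) hmeasure)

theorem le_dimH_range_of_pow_le_edist
    (hf : ∀ n a a', (∀ i < n, a i = a' i) → a n ≠ a' n → r ^ n ≤ C * edist (f a) (f a'))
    (hb : 1 < b) (hd0 : 0 < d) (hd : 1 ≤ b * r ^ (d : ℝ)) : d ≤ dimH (range f) := by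
  -- The base-`b` expansion factors through `f` as a `d`-Hölder map onto `[0, 1]`.
  have hholder (a a' : ℕ → Fin b) : edist (Real.ofDigits a) (Real.ofDigits a') ≤
      (C ^ (d : ℝ) : ℝ≥0) * edist (f a) (f a') ^ (d : ℝ) := by
    rcases eq_or_ne a a' with rfl | hne
    · simp
    have hagree : ∀ i < PiNat.firstDiff a a', a i = a' i :=
      fun i hi => PiNat.apply_eq_of_lt_firstDiff hi
    set n := PiNat.firstDiff a a'
    calc edist (Real.ofDigits a) (Real.ofDigits a') ≤ ((b : ℝ≥0)⁻¹ ^ n : ℝ≥0) := by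
          rw [edist_nndist, ENNReal.coe_le_coe, ← NNReal.coe_le_coe]
          simpa [Real.dist_eq] using Real.abs_ofDigits_sub_ofDigits_le hagree
      _ ≤ ((r ^ (d : ℝ)) ^ n : ℝ≥0) := by
          gcongr
          exact (inv_le_iff_one_le_mul₀' (Nat.cast_pos.2 (zero_lt_one.trans hb))).2 hd
      _ = (r ^ n : ℝ≥0∞) ^ (d : ℝ) := by
          rw [← NNReal.rpow_mul_natCast, mul_comm, NNReal.rpow_natCast_mul,
            ENNReal.coe_rpow_of_nonneg _ d.coe_nonneg, ENNReal.coe_pow]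
      _ ≤ (C * edist (f a) (f a')) ^ (d : ℝ) :=
          ENNReal.rpow_le_rpow (hf n a a' hagree (PiNat.apply_firstDiff_ne hne)) d.coe_nonneg
      _ = _ := by
          rw [ENNReal.mul_rpow_of_nonneg _ _ d.coe_nonneg,
            ENNReal.coe_rpow_of_nonneg _ d.coe_nonneg]
  have hunit : Icc (0 : ℝ) 1 ⊆ range (Real.ofDigits (b := b)) := by
    rw [← image_univ]
    exact Real.ofDigits_SurjOn hb
  have hdim : 1 ≤ dimH (range f) / d :=
    calc 1 = dimH (Icc (0 : ℝ) 1) := by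
          rw [Real.dimH_of_nonempty_interior (by simp), Module.finrank_self, Nat.cast_one]
      _ ≤ dimH (range (Real.ofDigits (b := b))) := dimH_mono hunit
      _ ≤ dimH (range f) / d := dimH_range_le_div_of_edist_le hd0 hholder
  simpa using ENNReal.mul_le_of_le_div hdim

end SymbolicCoding

section DigitSum

variable {b : ℕ}

/-- The real number with digit sequence `a` in base `l⁻¹`, the zeroth digit being the integer part.
For `b * l < 1` its values form a self-similar Cantor set with contraction ratio `l`. -/
noncomputable def digitSum (l : ℝ) (a : ℕ → Fin b) : ℝ := ∑' i, ((a i : ℕ) : ℝ) * l ^ i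

theorem digit_le (x : Fin b) : ((x : ℕ) : ℝ) ≤ b - 1 := by
  rw [le_sub_iff_add_le]
  exact_mod_cast x.isLt

variable {l : ℝ} (h0 : 0 ≤ l) (h1 : l < 1)
include h0

theorem digitSum_nonneg (a : ℕ → Fin b) : 0 ≤ digitSum l a :=
  tsum_nonneg fun _ => by positivity

include h1

theorem summable_digit_mul_pow (a : ℕ → Fin b) : Summable fun i => ((a i : ℕ) : ℝ) * l ^ i :=
  .of_nonneg_of_le (fun _ => by positivity)
    (fun i => mul_le_mul_of_nonneg_right (digit_le (a i)) (pow_nonneg h0 i))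
    ((summable_geometric_of_lt_one h0 h1).mul_left _)

theorem digitSum_le (a : ℕ → Fin b) : digitSum l a ≤ (b - 1) / (1 - l) := by
  rw [div_eq_mul_inv, ← tsum_geometric_of_lt_one h0 h1, ← tsum_mul_left]
  exact (summable_digit_mul_pow h0 h1 a).tsum_le_tsum
    (fun i => mul_le_mul_of_nonneg_right (digit_le (a i)) (pow_nonneg h0 i))
    ((summable_geometric_of_lt_one h0 h1).mul_left _)

theorem digitSum_eq_sum_add (a : ℕ → Fin b) (n : ℕ) :
    digitSum l a = ∑ i ∈ Finset.range n, ((a i : ℕ) : ℝ) * l ^ i +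
      l ^ n * digitSum l fun i => a (i + n) := by
  rw [digitSum, ← (summable_digit_mul_pow h0 h1 a).sum_add_tsum_nat_add n, digitSum,
    ← tsum_mul_left]
  simp only [pow_add, mul_assoc, mul_comm (l ^ n)]

theorem dist_digitSum_of_forall_lt_eq {a a' : ℕ → Fin b} {n : ℕ} (h : ∀ i < n, a i = a' i) :
    dist (digitSum l a) (digitSum l a') =
      l ^ n * dist (digitSum l fun i => a (i + n)) (digitSum l fun i => a' (i + n)) := by
  have hagree : ∑ i ∈ Finset.range n, ((a i : ℕ) : ℝ) * l ^ i =
      ∑ i ∈ Finset.range n, ((a' i : ℕ) : ℝ) * l ^ i :=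
    Finset.sum_congr rfl fun i hi => by rw [h i (Finset.mem_range.1 hi)]
  rw [digitSum_eq_sum_add h0 h1 a n, digitSum_eq_sum_add h0 h1 a' n, hagree, dist_add_left,
    Real.dist_eq, Real.dist_eq, ← mul_sub, abs_mul, abs_of_nonneg (pow_nonneg h0 n)]

theorem dist_digitSum_le (a a' : ℕ → Fin b) :
    dist (digitSum l a) (digitSum l a') ≤ (b - 1) / (1 - l) := by
  simpa using Real.dist_le_of_mem_Icc ⟨digitSum_nonneg h0 a, digitSum_le h0 h1 a⟩
    ⟨digitSum_nonneg h0 a', digitSum_le h0 h1 a'⟩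

theorem le_dist_digitSum_of_apply_zero_ne {a a' : ℕ → Fin b} (h : a 0 ≠ a' 0) :
    (1 - b * l) / (1 - l) ≤ dist (digitSum l a) (digitSum l a') := by
  wlog hlt : a 0 < a' 0 generalizing a a'
  · rw [dist_comm]
    exact this h.symm (h.symm.lt_of_le (not_lt.1 hlt))
  have hsplit (c : ℕ → Fin b) : digitSum l c = (c 0 : ℕ) + l * digitSum l fun i => c (i + 1) := by
    simpa using digitSum_eq_sum_add h0 h1 c 1
  have hdigit : ((a 0 : ℕ) : ℝ) + 1 ≤ (a' 0 : ℕ) := by exact_mod_cast hlt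
  have htail : l * digitSum l (fun i => a (i + 1)) ≤ l * ((b - 1) / (1 - l)) :=
    mul_le_mul_of_nonneg_left (digitSum_le h0 h1 _) h0
  have htail' : 0 ≤ l * digitSum l fun i => a' (i + 1) := mul_nonneg h0 (digitSum_nonneg h0 _)
  calc (1 - b * l) / (1 - l) = 1 - l * ((b - 1) / (1 - l)) := by
        have : 1 - l ≠ 0 := (sub_pos.2 h1).ne'
        field_simp
        ring
    _ ≤ digitSum l a' - digitSum l a := by
        rw [hsplit a, hsplit a']
        linarith
    _ ≤ dist (digitSum l a) (digitSum l a') := by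
        rw [dist_comm]
        exact le_abs_self _

end DigitSum

section DimensionOfDigitSums

variable {b : ℕ} {l : ℝ≥0} {a a' : ℕ → Fin b} {n : ℕ}

theorem edist_digitSum_le_mul_pow (h1 : l < 1) (h : ∀ i < n, a i = a' i) :
    edist (digitSum l a) (digitSum l a') ≤ ((b - 1) / (1 - l) : ℝ).toNNReal * l ^ n := by
  rw [edist_nndist, ← ENNReal.coe_pow, ← ENNReal.coe_mul, ENNReal.coe_le_coe,
    ← NNReal.coe_le_coe, coe_nndist, dist_digitSum_of_forall_lt_eq l.coe_nonneg h1 h, mul_comm]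
  push_cast
  gcongr
  exact (dist_digitSum_le l.coe_nonneg h1 _ _).trans (Real.le_coe_toNNReal _)

theorem pow_le_mul_edist_digitSum (h1 : l < 1) (hl : b * l < 1) (h : ∀ i < n, a i = a' i)
    (hne : a n ≠ a' n) :
    (l : ℝ≥0∞) ^ n ≤ (((1 - b * l) / (1 - l) : ℝ).toNNReal⁻¹ : ℝ≥0) *
      edist (digitSum l a) (digitSum l a') := by
  have hsep : (0 : ℝ) < (1 - b * l) / (1 - l) :=
    div_pos (sub_pos.2 (by exact_mod_cast hl)) (sub_pos.2 h1)
  rw [edist_nndist, ← ENNReal.coe_pow, ← ENNReal.coe_mul, ENNReal.coe_le_coe,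
    le_inv_mul_iff₀ (Real.toNNReal_pos.2 hsep), ← NNReal.coe_le_coe, coe_nndist,
    dist_digitSum_of_forall_lt_eq l.coe_nonneg h1 h, mul_comm]
  push_cast
  gcongr
  rw [Real.coe_toNNReal _ hsep.le]
  exact le_dist_digitSum_of_apply_zero_ne l.coe_nonneg h1 (by simpa using hne)

theorem dimH_range_digitSum {d : ℝ≥0} (hb : 1 < b) (hl : b * l < 1)
    (hd : b * l ^ (d : ℝ) = 1) : dimH (range (digitSum (b := b) l)) = d := by
  have hb1 : (1 : ℝ≥0) < b := by exact_mod_cast hb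
  have h1 : l < 1 := (le_mul_of_one_le_left' hb1.le).trans_lt hl
  have hd0 : 0 < d := pos_iff_ne_zero.2 fun h => hb1.ne' (by simpa [h] using hd)
  exact le_antisymm
    (dimH_range_le_of_edist_le_pow (fun _ _ _ => edist_digitSum_le_mul_pow h1) h1 hd.le)
    (le_dimH_range_of_pow_le_edist (fun _ _ _ => pow_le_mul_edist_digitSum h1 hl) hb hd0 hd.ge)

end DimensionOfDigitSums

theorem exists_nonempty_isBounded_dimH_eq {θ : ℝ≥0} (hθ : θ ≤ 1) :
    ∃ C : Set ℝ, C.Nonempty ∧ Bornology.IsBounded C ∧ dimH C = θ := by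
  rcases eq_or_ne θ 0 with rfl | h0
  · exact ⟨{0}, singleton_nonempty 0, Bornology.isBounded_singleton, by simp⟩
  rcases hθ.eq_or_lt with rfl | h1
  · refine ⟨Icc 0 1, nonempty_Icc.2 zero_le_one, isBounded_Icc 0 1, ?_⟩
    rw [Real.dimH_of_nonempty_interior (by simp), Module.finrank_self, Nat.cast_one,
      ENNReal.coe_one]
  have hθ0 : (0 : ℝ) < θ := NNReal.coe_pos.2 (pos_iff_ne_zero.2 h0)
  obtain ⟨l, hl⟩ : ∃ l : ℝ≥0, l = 2⁻¹ ^ (θ : ℝ)⁻¹ := ⟨_, rfl⟩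
  have hlθ : (2 : ℕ) * l ^ (θ : ℝ) = 1 := by
    rw [hl, ← NNReal.rpow_mul, inv_mul_cancel₀ hθ0.ne']
    norm_num
  have hlt : l < 2⁻¹ := by
    rw [hl]
    exact Real.rpow_lt_self_of_lt_one (by simp) (by simpa using two_inv_lt_one)
      ((one_lt_inv₀ hθ0).2 h1)
  have hl2 : (2 : ℕ) * l < 1 := by
    simpa using mul_lt_mul_of_pos_left hlt two_pos
  have hl1 : (l : ℝ) < 1 := NNReal.coe_lt_one.2 (hlt.trans two_inv_lt_one)
  exact ⟨range (digitSum (b := 2) l), range_nonempty _,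
    isBounded_range_iff.2 ⟨_, dist_digitSum_le l.coe_nonneg hl1⟩,
    dimH_range_digitSum one_lt_two hl2 hlθ⟩

section OpenApprox

variable {X : Type*} [PseudoEMetricSpace X] {O : Set X}

/-- Continuous functions increasing with `n` to the indicator function of the open set `O`. -/
noncomputable def openApprox (O : Set X) (n : ℕ) (x : X) : ℝ :=
  1 - thickenedIndicator (Nat.one_div_pos_of_nat (α := ℝ) (n := n)) Oᶜ x

theorem continuous_openApprox (O : Set X) (n : ℕ) : Continuous (openApprox O n) := by
  unfold openApprox
  fun_prop

theorem openApprox_nonneg (O : Set X) (n : ℕ) (x : X) : 0 ≤ openApprox O n x :=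
  sub_nonneg.2 (NNReal.coe_le_one.2 (thickenedIndicator_le_one _ _ x))

theorem openApprox_le_one (O : Set X) (n : ℕ) (x : X) : openApprox O n x ≤ 1 :=
  sub_le_self _ NNReal.zero_le_coe

theorem openApprox_eq_zero {x : X} (hx : x ∉ O) (n : ℕ) : openApprox O n x = 0 := by
  rw [openApprox, thickenedIndicator_one _ _ hx, NNReal.coe_one, sub_self]

theorem openApprox_le_succ (O : Set X) (n : ℕ) (x : X) :
    openApprox O n x ≤ openApprox O (n + 1) x :=
  sub_le_sub_left (NNReal.coe_le_coe.2 (thickenedIndicator_mono _ _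
    (Nat.one_div_le_one_div n.le_succ) Oᶜ x)) 1

theorem tendsto_openApprox (hO : IsOpen O) (x : X) :
    Tendsto (fun n => openApprox O n x) atTop (𝓝 (O.indicator 1 x)) := by
  have hcompl := tendsto_pi_nhds.1 (thickenedIndicator_tendsto_indicator_closure
    (fun n => Nat.one_div_pos_of_nat (α := ℝ) (n := n))
    (tendsto_one_div_add_atTop_nhds_zero_nat (𝕜 := ℝ)) Oᶜ) x
  have hlim := (NNReal.tendsto_coe.2 hcompl).const_sub 1
  rw [hO.isClosed_compl.closure_eq] at hlim
  convert! hlim using 2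
  by_cases hx : x ∈ O <;> simp [hx]

theorem tendsto_integral_openApprox {O : Set ℝ} (hO : IsOpen O) {x y : ℝ} (hxy : x ≤ y) :
    Tendsto (fun n => ∫ t in x..y, openApprox O n t) atTop (𝓝 (volume.real (O ∩ Ioc x y))) := by
  have hlim := intervalIntegral.tendsto_integral_filter_of_dominated_convergence
    (μ := volume) (a := x) (b := y) (F := openApprox O) (f := O.indicator 1) (fun _ => 1)
    (.of_forall fun n => (continuous_openApprox O n).aestronglyMeasurable)
    (.of_forall fun n => .of_forall fun t _ => by
      rw [Real.norm_of_nonneg (openApprox_nonneg O n t)]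
      exact openApprox_le_one O n t)
    intervalIntegrable_const (.of_forall fun t _ => tendsto_openApprox hO t)
  rwa [intervalIntegral.integral_of_le hxy, integral_indicator_one hO.measurableSet,
    measureReal_restrict_apply hO.measurableSet] at hlim

end OpenApprox

section Weights

theorem exists_one_le_forall_eventually_one_le_mul {ι : Type*} [Countable ι] {m : ι → ℕ → ℝ}
    (hm : ∀ i k, 0 < m i k) :
    ∃ w : ℕ → ℝ, (∀ k, 1 ≤ w k) ∧ ∀ i, ∀ᶠ k in atTop, 1 ≤ w k * m i k := by
  rcases isEmpty_or_nonempty ι with _ | _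
  · exact ⟨1, fun _ => le_rfl, isEmptyElim⟩
  obtain ⟨e, he⟩ := exists_surjective_nat ι
  have hinv (k j : ℕ) : 0 ≤ (m (e j) k)⁻¹ := (inv_pos.2 (hm _ _)).le
  refine ⟨fun k => 1 + ∑ j ∈ Finset.range (k + 1), (m (e j) k)⁻¹,
    fun k => le_add_of_nonneg_right (Finset.sum_nonneg fun j _ => hinv k j), fun i => ?_⟩
  obtain ⟨j, rfl⟩ := he i
  filter_upwards [eventually_ge_atTop j] with k hk
  have hterm : (m (e j) k)⁻¹ ≤ 1 + ∑ j ∈ Finset.range (k + 1), (m (e j) k)⁻¹ :=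
    le_add_of_nonneg_of_le zero_le_one <| Finset.single_le_sum (fun j _ => hinv k j)
      (Finset.mem_range_succ_iff.2 hk)
  exact (inv_le_iff_one_le_mul₀ (hm _ _)).1 hterm

theorem volume_real_inter_Ioc_pos {O : Set ℝ} (hO : IsOpen O) (hd : Dense O) {x y : ℝ}
    (hxy : x < y) : 0 < volume.real (O ∩ Ioc x y) := by
  have hopen : 0 < volume (Ioo x y ∩ O) := (isOpen_Ioo.inter hO).measure_pos _
    (hd.inter_open_nonempty _ isOpen_Ioo (nonempty_Ioo.2 hxy))
  refine ENNReal.toReal_pos (hopen.trans_le (measure_mono ?_)).ne'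
    (measure_ne_top_of_subset inter_subset_right measure_Ioc_lt_top.ne)
  exact fun t ht => ⟨ht.2, Ioo_subset_Ioc_self ht.1⟩

theorem exists_one_le_forall_eventually_one_le_mul_volume {O : ℕ → Set ℝ}
    (hO : ∀ k, IsOpen (O k)) (hd : ∀ k, Dense (O k)) :
    ∃ w : ℕ → ℝ, (∀ k, 1 ≤ w k) ∧ ∀ x y : ℝ, x < y →
      ∀ᶠ k in atTop, 1 ≤ w k * volume.real (O k ∩ Ioc x y) := by
  obtain ⟨w, hw1, hw⟩ := exists_one_le_forall_eventually_one_le_mul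
    (m := fun (p : {p : ℚ × ℚ // p.1 < p.2}) k => volume.real (O k ∩ Ioc (p.1.1 : ℝ) p.1.2))
    fun p k => volume_real_inter_Ioc_pos (hO k) (hd k) (Rat.cast_lt.2 p.2)
  refine ⟨w, hw1, fun x y hxy => ?_⟩
  obtain ⟨q, hxq, hqy⟩ := exists_rat_btwn hxy
  obtain ⟨r, hqr, hry⟩ := exists_rat_btwn hqy
  filter_upwards [hw ⟨(q, r), Rat.cast_lt.1 hqr⟩] with k hk
  refine hk.trans (mul_le_mul_of_nonneg_left (measureReal_mono ?_ ?_)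
    (zero_le_one.trans (hw1 k)))
  · exact inter_subset_inter_right _ (Ioc_subset_Ioc hxq.le hry.le)
  · exact measure_ne_top_of_subset inter_subset_right measure_Ioc_lt_top.ne

end Weights

theorem tendsto_sum_range_atTop_of_eventually_one_le {a : ℕ → ℕ → ℝ} {c : ℕ → ℝ}
    (ha : ∀ k n, 0 ≤ a k n) (hlim : ∀ k, Tendsto (a k) atTop (𝓝 (c k)))
    (hc : ∀ᶠ k in atTop, 1 ≤ c k) :
    Tendsto (fun n => ∑ k ∈ Finset.range n, a k n) atTop atTop := by
  have hc0 (k : ℕ) : 0 ≤ c k := ge_of_tendsto' (hlim k) (ha k)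
  have hsum : Tendsto (fun N => ∑ k ∈ Finset.range N, c k) atTop atTop := by
    refine (not_summable_iff_tendsto_nat_atTop_of_nonneg hc0).1 fun hs => ?_
    exact zero_lt_one.not_ge (ge_of_tendsto hs.tendsto_atTop_zero hc)
  refine tendsto_atTop.2 fun M => ?_
  obtain ⟨N, hN⟩ := (hsum.eventually_gt_atTop M).exists
  have hfin : Tendsto (fun n => ∑ k ∈ Finset.range N, a k n) atTop
      (𝓝 (∑ k ∈ Finset.range N, c k)) := tendsto_finsetSum _ fun k _ => hlim k
  filter_upwards [hfin.eventually_const_lt hN, eventually_ge_atTop N] with n hn hNn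
  exact hn.le.trans (Finset.sum_le_sum_of_subset_of_nonneg
    (Finset.range_subset_range.2 hNn) fun k _ _ => ha k n)

section WeightedApprox

variable {X : Type*} [PseudoEMetricSpace X] {O : ℕ → Set X} {w : ℕ → ℝ}

/-- Continuous functions increasing with `n` to `∑ k, w k • 1_{O k}`, for open sets `O k` and
weights `w k ≥ 0`. -/
noncomputable def weightedApprox (O : ℕ → Set X) (w : ℕ → ℝ) (n : ℕ) (x : X) : ℝ :=
  ∑ k ∈ Finset.range n, w k * openApprox (O k) n x

theorem continuous_weightedApprox (O : ℕ → Set X) (w : ℕ → ℝ) (n : ℕ) :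
    Continuous (weightedApprox O w n) :=
  continuous_finsetSum _ fun k _ => continuous_const.mul (continuous_openApprox (O k) n)

theorem weightedApprox_le_succ (hw : ∀ k, 0 ≤ w k) (n : ℕ) (x : X) :
    weightedApprox O w n x ≤ weightedApprox O w (n + 1) x := by
  rw [weightedApprox, weightedApprox, Finset.sum_range_succ _ n]
  exact le_add_of_le_of_nonneg
    (Finset.sum_le_sum fun k _ => mul_le_mul_of_nonneg_left (openApprox_le_succ (O k) n x) (hw k))
    (mul_nonneg (hw n) (openApprox_nonneg _ _ _))

theorem weightedApprox_le_sum (hw : ∀ k, 0 ≤ w k) {x : X} {j : ℕ} (hx : ∀ k ≥ j, x ∉ O k)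
    (n : ℕ) : weightedApprox O w n x ≤ ∑ k ∈ Finset.range j, w k := by
  calc weightedApprox O w n x ≤ ∑ k ∈ Finset.range n, if k < j then w k else 0 := by
        refine Finset.sum_le_sum fun k _ => ?_
        split_ifs with hk
        · exact mul_le_of_le_one_right (hw k) (openApprox_le_one _ _ _)
        · rw [openApprox_eq_zero (hx k (not_lt.1 hk)), mul_zero]
    _ = ∑ k ∈ Finset.range n with k < j, w k := (Finset.sum_filter _ _).symm
    _ ≤ ∑ k ∈ Finset.range j, w k := Finset.sum_le_sum_of_subset_of_nonneg
        (fun k hk => Finset.mem_range.2 (Finset.mem_filter.1 hk).2) fun k _ _ => hw k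

theorem tendsto_weightedApprox_atTop_iff (hO : ∀ k, IsOpen (O k)) (hanti : Antitone O)
    (hw : ∀ k, 1 ≤ w k) {x : X} :
    Tendsto (fun n => weightedApprox O w n x) atTop atTop ↔ x ∈ ⋂ k, O k := by
  have hw0 (k : ℕ) : 0 ≤ w k := zero_le_one.trans (hw k)
  refine ⟨fun h => mem_iInter.2 fun j => ?_, fun hx => ?_⟩
  · by_contra hj
    obtain ⟨n, hn⟩ := (h.eventually_gt_atTop (∑ k ∈ Finset.range j, w k)).exists
    exact hn.not_ge (weightedApprox_le_sum hw0 (fun k hk hxk => hj (hanti hk hxk)) n)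
  · refine tendsto_sum_range_atTop_of_eventually_one_le
      (fun k n => mul_nonneg (hw0 k) (openApprox_nonneg _ _ _))
      (fun k => (tendsto_openApprox (hO k) x).const_mul (w k)) (.of_forall fun k => ?_)
    simpa [indicator_of_mem (mem_iInter.1 hx k)] using hw k

theorem tendsto_integral_weightedApprox_atTop {O : ℕ → Set ℝ} (hO : ∀ k, IsOpen (O k))
    (hw : ∀ k, 0 ≤ w k) {x y : ℝ} (hxy : x ≤ y)
    (hmass : ∀ᶠ k in atTop, 1 ≤ w k * volume.real (O k ∩ Ioc x y)) :
    Tendsto (fun n => ∫ t in x..y, weightedApprox O w n t) atTop atTop := by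
  have hint (n : ℕ) : ∫ t in x..y, weightedApprox O w n t =
      ∑ k ∈ Finset.range n, w k * ∫ t in x..y, openApprox (O k) n t := by
    have hcont (k : ℕ) : Continuous fun t => w k * openApprox (O k) n t :=
      continuous_const.mul (continuous_openApprox (O k) n)
    simp only [weightedApprox, intervalIntegral.integral_finsetSum fun k _ =>
      (hcont k).intervalIntegrable x y, intervalIntegral.integral_const_mul]
  simp only [hint]
  exact tendsto_sum_range_atTop_of_eventually_one_le
    (fun k n => mul_nonneg (hw k)
      (intervalIntegral.integral_nonneg hxy fun t _ => openApprox_nonneg _ _ _))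
    (fun k => (tendsto_integral_openApprox (hO k) hxy).const_mul (w k)) hmass

end WeightedApprox

theorem exists_isMaxFamily_infinitySet_eq {G : Set ℝ} (hG : IsGδ G) (hd : Dense G) (I : Set ℝ) :
    ∃ f : ℕ → ℝ → ℝ, IsMaxFamily I f ∧ infinitySet I f = I ∩ G := by
  obtain ⟨O, hO, hanti, rfl⟩ : ∃ O : ℕ → Set ℝ, (∀ k, IsOpen (O k)) ∧ Antitone O ∧
      G = ⋂ k, O k := by
    obtain ⟨V, hV, rfl⟩ := isGδ_iff_eq_iInter_nat.1 hG
    exact ⟨dissipate V, fun k => (finite_Iic k).isOpen_biInter fun j _ => hV j,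
      antitone_dissipate, iInter_dissipate.symm⟩
  obtain ⟨w, hw1, hmass⟩ := exists_one_le_forall_eventually_one_le_mul_volume hO
    fun k => hd.mono (iInter_subset O k)
  have hw0 (k : ℕ) : 0 ≤ w k := zero_le_one.trans (hw1 k)
  refine ⟨weightedApprox O w, ⟨fun n => (continuous_weightedApprox O w n).continuousOn,
    fun n x _ => weightedApprox_le_succ hw0 n x, fun x _ y _ hxy =>
      tendsto_integral_weightedApprox_atTop hO hw0 hxy.le (hmass x y hxy)⟩, ?_⟩
  ext x
  exact and_congr_right fun _ => tendsto_weightedApprox_atTop_iff hO hanti hw1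

theorem interior_inter_nonempty_of_ordConnected {I O : Set ℝ} (hI : I.OrdConnected)
    (hI' : I.Nontrivial) (hO : IsOpen O) (h : (I ∩ O).Nonempty) : (interior I ∩ O).Nonempty := by
  have hconv : Convex ℝ I := convex_iff_ordConnected.2 hI
  rw [← closure_inter_open_nonempty_iff hO,
    hconv.closure_interior_eq_closure_of_nonempty_interior
      (hconv.nontrivial_iff_nonempty_interior.1 hI')]
  exact h.mono (inter_subset_inter_left O subset_closure)

end MaxFamily

theorem mainTheorem2 (I : Set ℝ) (hI : I.OrdConnected) (hI' : I.Nontrivial)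
    (θ : ℝ) (hθ : θ ∈ Set.Icc (0 : ℝ) 1) :
    ∃ f : ℕ → ℝ → ℝ, MaxFamily.IsMaxFamily I f ∧
      ∀ U : Set ℝ, MaxFamily.IsOpenSubinterval I U →
        dimH (MaxFamily.infinitySet I f ∩ U) = ENNReal.ofReal θ := by
  obtain ⟨C, hCne, hCbdd, hdimC⟩ :=
    MaxFamily.exists_nonempty_isBounded_dimH_eq (Real.toNNReal_le_one.2 hθ.2)
  obtain ⟨G, hG, hGdense, hdimG⟩ :=
    MaxFamily.exists_isGδ_dense_forall_dimH_inter_eq ℝ hCne hCbdd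
  obtain ⟨f, hf, hfG⟩ := MaxFamily.exists_isMaxFamily_infinitySet_eq hG hGdense I
  refine ⟨f, hf, fun U hU => ?_⟩
  obtain ⟨O, hO, rfl⟩ := hU.relOpen
  have hne : (interior I ∩ O).Nonempty :=
    MaxFamily.interior_inter_nonempty_of_ordConnected hI hI' hO hU.nonempty
  rw [hfG, ENNReal.ofReal, ← hdimC]
  refine le_antisymm ?_ ?_
  · rw [← hdimG univ isOpen_univ univ_nonempty, inter_univ]
    exact dimH_mono (inter_subset_left.trans inter_subset_right)
  · rw [← hdimG _ (isOpen_interior.inter hO) hne]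
    exact dimH_mono fun x hx =>
      ⟨⟨interior_subset hx.2.1, hx.1⟩, interior_subset hx.2.1, hx.2.2⟩
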